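/- For $n\in\mathbb{N}_0$ and $a\in\mathbb{R}$ let $$L_n^{a}(x)=\sum_{j=0}^{n}\binom{n+a}{n-j}\frac{(-x)^j}{j!}$$ be the classical Laguerre polynomial. Let $m\ge 1$ be an integer and let $-1<\alpha<0$. For $k\ge 1$ let $$L_{m,m+k}^{\mathrm{III},\alpha}(x)=-x\,L_m^{-\alpha-1}(-x)\,\frac{d}{dx}L_{k-1}^{\alpha+1}(x)+(m+1)\,L_{m+1}^{-\alpha-2}(-x)\,L_{k-1}^{\alpha+1}(x)$$ be the Type III exceptional $X_m$-Laguerre polynomial of degree $m+k$. **Theorem.** The polynomial $L_m^{-\alpha-1}(-x)$ has exactly $m$ distinct real roots $z_1<\dots<z_m$; for every $k\ge 1$ the polynomial $L_{m,m+k}^{\mathrm{III},\alpha}$ has exactly $m$ distinct negative roots (its exceptional roots) $\zeta_{k,1}<\dots<\zeta_{k,m}$ and at least one positive root. As $k\to\infty$: (a) the exceptional roots converge to the roots of $L_m^{-\alpha-1}(-x)$, that is, $\zeta_{k,i}\to z_i$ for each $i=1,\dots,m$; (b) the smallest positive root of $L_{m,m+k}^{\mathrm{III},\alpha}$ tends to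 $0$. -/

import Mathlib

open Polynomial Filter Topology

/-- The classical (generalized) Laguerre polynomial
`L_n^a(x) = ∑_{j=0}^n binom(n + a, n - j) (-x)^j / j!`, for an arbitrary real parameter `a`. -/
noncomputable def laguerrePoly (n : ℕ) (a : ℝ) : ℝ[X] :=
  ∑ j ∈ Finset.range (n + 1),
    C (Ring.choose ((n : ℝ) + a) (n - j) * (-1) ^ j / (j.factorial : ℝ)) * X ^ j

/-- The polynomial `x ↦ L_n^a(-x)`. -/
noncomputable def laguerrePolyNeg (n : ℕ) (a : ℝ) : ℝ[X] :=
  (laguerrePoly n a).comp (-X)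

/-- The first-order operator
`A_m^{III,b}[y](x) = x L_m^{-b}(-x) y'(x) - (m+1) L_{m+1}^{-b-1}(-x) y(x)`. -/
noncomputable def typeIIIOperatorA (m : ℕ) (b : ℝ) (y : ℝ[X]) : ℝ[X] :=
  X * laguerrePolyNeg m (-b) * derivative y
    - C ((m : ℝ) + 1) * laguerrePolyNeg (m + 1) (-b - 1) * y

/-- The Type III exceptional `X_m`-Laguerre polynomial `L_{m,n}^{III,α}`, of degree `n`, defined
for `n = 0` and `n ≥ m + 1`. There is no such polynomial for `1 ≤ n ≤ m`; the value `0` there is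
a placeholder. -/
noncomputable def typeIIILaguerre (m n : ℕ) (α : ℝ) : ℝ[X] :=
  if n = 0 then 1
  else if m + 1 ≤ n then -typeIIIOperatorA m (α + 1) (laguerrePoly (n - m - 1) (α + 1))
  else 0

/-! With p = L_m^{-α-1}(-x), q = L_{k-1}^{α+1} and c = α+1, a contiguous relation rewrites the
exceptional polynomial as W = (x - c) p q + x (p' q - p q'). Both parameters exceed -1, so q has
simple positive zeros while p > 0 on [0, ∞). At a zero of q only -x p q' survives, and its sign
alternates. The signs at 0 and at infinity then give k positive roots, the smallest below the first
zero of q. Replacing x by -x swaps the two factors and turns c into -c, up to sign. So the m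
negative roots interlace, after reflection, with the zeros w_i of L_m^{-α-1}. The degree bound m + k
shows that nothing else occurs (`typeIIILaguerre_exists_roots`).

(b) follows from a bound of order 1/n on the first Laguerre zero (`laguerrePoly_smallest_root_le`).
For (a), the logarithmic derivative of L_n^{α+1}(-t) at fixed t > 0 grows without bound in n
(`laguerrePoly_derivative_le`). It dominates every other term, forcing a sign change of the
reflected W between w_i and any t slightly to its right (`wronskiOp_root_near`). -/

/-! ### Laguerre coefficients, differential equation and contiguous relation. -/

theorem Ring.choose_succ_mul_succ (r : ℝ) (k : ℕ) :
    Ring.choose r (k + 1) * ((k : ℝ) + 1) = Ring.choose r k * (r - k) := by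
  have h1 := Ring.descPochhammer_eq_factorial_smul_choose r (k + 1)
  have h0 := Ring.descPochhammer_eq_factorial_smul_choose r k
  rw [descPochhammer_succ_right, smeval_mul, h0] at h1
  simp only [smeval_sub, smeval_X, smeval_natCast, nsmul_eq_mul, pow_one, pow_zero, mul_one,
    Nat.factorial_succ, Nat.cast_mul, Nat.cast_succ] at h1
  have hk : (k.factorial : ℝ) ≠ 0 := by positivity
  apply mul_left_cancel₀ hk
  linarith

theorem laguerrePoly_coeff (n : ℕ) (a : ℝ) (j : ℕ) :
    (laguerrePoly n a).coeff j =
      if j ≤ n then Ring.choose ((n : ℝ) + a) (n - j) * (-1) ^ j / (j.factorial : ℝ) else 0 := by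
  simp only [laguerrePoly, finsetSum_coeff, coeff_C_mul, coeff_X_pow, mul_ite, mul_one, mul_zero]
  rw [Finset.sum_ite_eq]
  simp

theorem laguerrePoly_natDegree_le (n : ℕ) (a : ℝ) : (laguerrePoly n a).natDegree ≤ n := by
  rw [natDegree_le_iff_coeff_eq_zero]
  intro N hN
  rw [laguerrePoly_coeff, if_neg (by omega)]

theorem laguerrePoly_coeff_self (n : ℕ) (a : ℝ) :
    (laguerrePoly n a).coeff n = (-1) ^ n / (n.factorial : ℝ) := by
  simp [laguerrePoly_coeff]

theorem laguerrePoly_coeff_succ (n : ℕ) (a : ℝ) (j : ℕ) :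
    ((j : ℝ) + 1) * (j + a + 1) * (laguerrePoly n a).coeff (j + 1) =
      -((n : ℝ) - j) * (laguerrePoly n a).coeff j := by
  rw [laguerrePoly_coeff, laguerrePoly_coeff]
  rcases lt_trichotomy j n with h | h | h
  · obtain ⟨k, rfl⟩ := Nat.exists_eq_add_of_lt h
    rw [if_pos (by omega), if_pos (by omega), show j + k + 1 - (j + 1) = k by omega,
      show j + k + 1 - j = k + 1 by omega, Nat.factorial_succ]
    have := Ring.choose_succ_mul_succ (((j + k + 1 : ℕ) : ℝ) + a) k
    push_cast at this ⊢
    field_simp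
    rw [pow_succ]
    linear_combination (-1) ^ j * this
  · subst h
    simp
  · rw [if_neg (by omega), if_neg (by omega)]
    simp

theorem laguerrePoly_ode (n : ℕ) (a : ℝ) :
    X * derivative (derivative (laguerrePoly n a)) +
      (C (a + 1) - X) * derivative (laguerrePoly n a) + C (n : ℝ) * laguerrePoly n a = 0 := by
  ext j
  have := laguerrePoly_coeff_succ n a j
  cases j with
  | zero =>
    simp only [sub_mul, coeff_add, coeff_sub, coeff_derivative, mul_coeff_zero, coeff_X_zero,
      coeff_C_zero, coeff_zero]
    push_cast at this ⊢
    linear_combination this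
  | succ j =>
    simp only [sub_mul, coeff_add, coeff_sub, coeff_C_mul, coeff_derivative, coeff_X_mul,
      coeff_zero]
    push_cast at this ⊢
    linear_combination this

theorem laguerrePoly_succ (n : ℕ) (a : ℝ) :
    C ((n : ℝ) + 1) * laguerrePoly (n + 1) (a - 1) =
      (C a - X) * laguerrePoly n a + X * derivative (laguerrePoly n a) := by
  have key : ∀ j : ℕ, j ≤ n → ((n : ℝ) + 1 - j) * Ring.choose ((n : ℝ) + a) (n + 1 - j) =
      (a + j) * Ring.choose ((n : ℝ) + a) (n - j) := by
    intro j hj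
    obtain ⟨k, rfl⟩ := Nat.exists_eq_add_of_le hj
    rw [show j + k + 1 - j = k + 1 by omega, show j + k - j = k by omega]
    have := Ring.choose_succ_mul_succ (((j + k : ℕ) : ℝ) + a) k
    push_cast at this ⊢
    linear_combination this
  have cast : (((n + 1 : ℕ) : ℝ) + (a - 1)) = n + a := by push_cast; ring
  ext j
  cases j with
  | zero =>
    simp only [sub_mul, coeff_add, coeff_sub, mul_coeff_zero, coeff_C_zero, coeff_X_zero,
      laguerrePoly_coeff, cast]
    have := key 0 (by omega)
    simp at this ⊢
    linear_combination this
  | succ j =>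
    simp only [sub_mul, coeff_add, coeff_sub, coeff_C_mul, coeff_derivative, coeff_X_mul,
      laguerrePoly_coeff, cast]
    rcases lt_trichotomy j n with h | h | h
    · have := key (j + 1) h
      rw [if_pos (by omega), if_pos (by omega), if_pos (by omega), Nat.factorial_succ]
      rw [show n + 1 - (j + 1) = n - j by omega] at *
      push_cast at this ⊢
      field_simp
      rw [pow_succ]
      linear_combination - (-1) ^ j * this
    · subst h
      rw [if_pos (by omega), if_neg (by omega), if_pos (by omega), Nat.factorial_succ]
      push_cast
      simp
      field_simp
      ring
    · rw [if_neg (by omega), if_neg (by omega), if_neg (by omega)]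
      simp

/-! ### The bilinear operator and the signs of a polynomial with prescribed zeros. -/

/-- The first-order bilinear operator `(X - c) p q + X (p' q - p q')`. -/
noncomputable def wronskiOp (c : ℝ) (p q : ℝ[X]) : ℝ[X] :=
  (X - C c) * p * q + X * (derivative p * q - p * derivative q)

/-- The polynomial `d ∏ (x_j - X)`. -/
noncomputable def rootProd {n : ℕ} (d : ℝ) (x : Fin n → ℝ) : ℝ[X] :=
  C d * ∏ j, (C (x j) - X)

theorem sign_prod_pos {n : ℕ} (g : Fin n → ℝ) (s : Finset (Fin n)) (k : ℕ)
    (hk : (s.filter fun j => g j < 0).card = k) (h0 : ∀ j ∈ s, g j ≠ 0) :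
    0 < (-1) ^ k * ∏ j ∈ s, g j := by
  rw [← hk, ← Finset.prod_filter_mul_prod_filter_not s (fun j => g j < 0), ← mul_assoc,
    ← Finset.prod_const, ← Finset.prod_mul_distrib]
  refine mul_pos (Finset.prod_pos fun j hj => ?_) (Finset.prod_pos fun j hj => ?_)
  · have := (Finset.mem_filter.1 hj).2
    linarith
  · have h := Finset.mem_filter.1 hj
    exact lt_of_le_of_ne (not_lt.1 h.2) (h0 j h.1).symm

theorem rootProd_eval {n : ℕ} (d : ℝ) (x : Fin n → ℝ) (t : ℝ) :
    (rootProd d x).eval t = d * ∏ j, (x j - t) := by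
  simp [rootProd, eval_prod]

theorem rootProd_eval_self {n : ℕ} (d : ℝ) (x : Fin n → ℝ) (i : Fin n) :
    (rootProd d x).eval (x i) = 0 := by
  rw [rootProd_eval, Finset.prod_eq_zero (Finset.mem_univ i) (sub_self _), mul_zero]

theorem rootProd_derivative_eval {n : ℕ} (d : ℝ) (x : Fin n → ℝ) (i : Fin n) :
    (derivative (rootProd d x)).eval (x i) = - (d * ∏ j ∈ Finset.univ.erase i, (x j - x i)) := by
  have h : rootProd d x = (C (x i) - X) * (C d * ∏ j ∈ Finset.univ.erase i, (C (x j) - X)) := by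
    rw [rootProd, ← Finset.mul_prod_erase _ _ (Finset.mem_univ i)]
    ring
  rw [h, derivative_mul]
  simp [eval_prod]

theorem rootProd_sign {n : ℕ} {d : ℝ} (hd : 0 < d) (x : Fin n → ℝ) (t : ℝ) (k : ℕ) (hk : k ≤ n)
    (hlt : ∀ j : Fin n, (j : ℕ) < k → x j < t) (hgt : ∀ j : Fin n, k ≤ j → t < x j) :
    0 < (-1) ^ k * (rootProd d x).eval t := by
  rw [rootProd_eval, mul_left_comm]
  refine mul_pos hd (sign_prod_pos _ _ k ?_ fun j _ => ?_)
  · have : (Finset.univ.filter fun j : Fin n => x j - t < 0) =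
        Finset.univ.filter fun j : Fin n => (j : ℕ) < k := by
      refine Finset.filter_congr fun j _ => ⟨fun h => ?_, fun h => ?_⟩
      · by_contra hc
        linarith [hgt j (by omega)]
      · linarith [hlt j h]
    rw [this, Fin.card_filter_val_lt, min_eq_right hk]
  · rcases lt_or_ge (j : ℕ) k with h | h
    · have := hlt j h
      exact (by linarith : x j - t < 0).ne
    · have := hgt j h
      exact (by linarith : 0 < x j - t).ne'

theorem rootProd_derivative_sign {n : ℕ} {d : ℝ} (hd : 0 < d) {x : Fin n → ℝ} (hx : StrictMono x)
    (i : Fin n) : (-1) ^ (i : ℕ) * (derivative (rootProd d x)).eval (x i) < 0 := by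
  rw [rootProd_derivative_eval, mul_neg, neg_lt_zero, mul_left_comm]
  refine mul_pos hd (sign_prod_pos _ _ _ ?_ fun j hj => ?_)
  · have : ((Finset.univ.erase i).filter fun j : Fin n => x j - x i < 0) =
        Finset.univ.filter fun j : Fin n => (j : ℕ) < i := by
      ext j
      simp only [Finset.mem_filter, Finset.mem_erase, Finset.mem_univ, and_true, sub_neg,
        hx.lt_iff_lt, true_and, Fin.lt_def]
      constructor
      · exact fun h => h.2
      · exact fun h => ⟨fun e => by simp [e] at h, h⟩
    rw [this, Fin.card_filter_val_lt, min_eq_right i.2.le]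
  · have := hx.injective.ne (Finset.ne_of_mem_erase hj)
    exact sub_ne_zero.2 this

theorem rootProd_sign_eventually {n : ℕ} {d : ℝ} (hd : 0 < d) (x : Fin n → ℝ) :
    ∀ᶠ t in atTop, 0 < (-1) ^ n * (rootProd d x).eval t := by
  filter_upwards [eventually_all.2 fun j => eventually_gt_atTop (x j)] with t ht
  exact rootProd_sign hd x t n le_rfl (fun j _ => ht j) (fun j hj => absurd j.2 (by omega))

theorem rootProd_ne_zero {n : ℕ} {d : ℝ} (hd : 0 < d) (x : Fin n → ℝ) : rootProd d x ≠ 0 := by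
  intro h
  obtain ⟨t, ht⟩ := (rootProd_sign_eventually hd x).exists
  simp [h] at ht

/-- Dividing by t p q leaves 1 - c/t + p'/p - q'/q, which tends to 1. -/
theorem wronskiOp_sign_eventually (c : ℝ) {p q : ℝ[X]} (hp : p ≠ 0) (hq : q ≠ 0) :
    ∀ᶠ t in atTop, 0 < p.eval t * q.eval t * (wronskiOp c p q).eval t := by
  have h1 := div_tendsto_atTop_zero_of_degree_lt _ _ (degree_derivative_lt hp)
  have h2 := div_tendsto_atTop_zero_of_degree_lt _ _ (degree_derivative_lt hq)
  have h3 : Tendsto (fun t : ℝ => c / t) atTop (𝓝 0) := tendsto_const_nhds.div_atTop tendsto_id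
  have h := ((tendsto_const_nhds (x := (1 : ℝ))).sub h3).add (h1.sub h2)
  simp only [sub_zero, add_zero] at h
  filter_upwards [h.eventually_const_lt one_pos, eventually_gt_atTop 0,
    (p.eventually_atTop_not_isRoot hp), (q.eventually_atTop_not_isRoot hq)] with t ht t0 hpt hqt
  rw [IsRoot.def] at hpt hqt
  have e : p.eval t * q.eval t * (wronskiOp c p q).eval t = t * (p.eval t * q.eval t) ^ 2 *
      (1 - c / t + ((derivative p).eval t / p.eval t - (derivative q).eval t / q.eval t)) := by
    simp only [wronskiOp, eval_add, eval_mul, eval_sub, eval_X, eval_C]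
    field_simp
  rw [e]
  have : 0 < (p.eval t * q.eval t) ^ 2 := by positivity
  exact mul_pos (mul_pos t0 this) ht

/-! ### Interlacing roots from sign changes. -/

theorem exists_root_of_mul_neg (f : ℝ[X]) {a b : ℝ} (hab : a < b)
    (h : f.eval a * f.eval b < 0) : ∃ r, a < r ∧ r < b ∧ f.IsRoot r := by
  have hc : ContinuousOn (fun t => f.eval t) (Set.Icc a b) := f.continuous.continuousOn
  rcases mul_neg_iff.1 h with ⟨h1, h2⟩ | ⟨h1, h2⟩
  · obtain ⟨r, hr, h0⟩ := intermediate_value_Ioo' hab.le hc ⟨h2, h1⟩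
    exact ⟨r, hr.1, hr.2, h0⟩
  · obtain ⟨r, hr, h0⟩ := intermediate_value_Ioo hab.le hc ⟨h1, h2⟩
    exact ⟨r, hr.1, hr.2, h0⟩

theorem exists_interlacing_roots {n : ℕ} {w : Fin n → ℝ} (hw : StrictMono w) (g : ℝ[X])
    (hg : ∀ i : Fin n, 0 < (-1) ^ (i : ℕ) * g.eval (w i))
    (hM : ∀ᶠ t in atTop, 0 < (-1) ^ n * g.eval t) :
    ∃ r : Fin n → ℝ, StrictMono r ∧ (∀ i, w i < r i) ∧ (∀ i l, i < l → r i < w l) ∧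
      ∀ i, g.IsRoot (r i) := by
  have key : ∀ i : Fin n, ∃ b, w i < b ∧ (∀ l, i < l → b ≤ w l) ∧
      0 < (-1) ^ ((i : ℕ) + 1) * g.eval b := by
    intro i
    -- The right end of the interval is the next node, or a far point when `i` is the last index.
    by_cases hi : (i : ℕ) + 1 < n
    · refine ⟨w ⟨i + 1, hi⟩, hw (Fin.lt_def.2 (by simp)), fun l hl => hw.monotone ?_, ?_⟩
      · exact Fin.le_def.2 (by simpa using Fin.lt_def.1 hl)
      · exact hg ⟨i + 1, hi⟩
    · obtain ⟨b, hb1, hb2⟩ := (hM.and (eventually_gt_atTop (w i))).exists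
      refine ⟨b, hb2, fun l hl => ?_, ?_⟩
      · have := Fin.lt_def.1 hl
        omega
      · rwa [show (i : ℕ) + 1 = n by omega]
  have key2 : ∀ i : Fin n, ∃ r, w i < r ∧ (∀ l, i < l → r < w l) ∧ g.IsRoot r := by
    intro i
    obtain ⟨b, h1, h2, h3⟩ := key i
    have hneg : g.eval (w i) * g.eval b < 0 := by
      have h := mul_pos (hg i) h3
      have e : (-1 : ℝ) ^ (i : ℕ) * g.eval (w i) * ((-1) ^ ((i : ℕ) + 1) * g.eval b) =
          - (((-1) ^ (i : ℕ)) ^ 2 * (g.eval (w i) * g.eval b)) := by ring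
      rw [e, ← pow_mul, mul_comm (i : ℕ) 2, pow_mul] at h
      norm_num at h
      exact h
    obtain ⟨r, hr1, hr2, hr3⟩ := exists_root_of_mul_neg g h1 hneg
    exact ⟨r, hr1, fun l hl => hr2.trans_le (h2 l hl), hr3⟩
  choose r h1 h2 h3 using key2
  exact ⟨r, fun i l hil => (h2 i l hil).trans (h1 l), h1, h2, h3⟩

theorem wronskiOp_eval_root {c d : ℝ} {n : ℕ} (p : ℝ[X]) (x : Fin n → ℝ) (i : Fin n) :
    (wronskiOp c p (rootProd d x)).eval (x i) =
      - (x i * p.eval (x i) * (derivative (rootProd d x)).eval (x i)) := by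
  simp only [wronskiOp, eval_add, eval_mul, eval_sub, eval_X, eval_C, rootProd_eval_self]
  ring

theorem wronskiOp_rootProd_sign {n : ℕ} {d : ℝ} (hd : 0 < d) {x : Fin n → ℝ}
    (hx : StrictMono x) (hx0 : ∀ i, 0 < x i) {p : ℝ[X]} (hp : ∀ t, 0 ≤ t → 0 < p.eval t)
    (c : ℝ) :
    (∀ i : Fin n, 0 < (-1) ^ (i : ℕ) * (wronskiOp c p (rootProd d x)).eval (x i)) ∧
    ∀ᶠ t in atTop, 0 < (-1) ^ n * (wronskiOp c p (rootProd d x)).eval t := by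
  constructor
  · intro i
    rw [wronskiOp_eval_root]
    have h1 := rootProd_derivative_sign hd hx i
    have h2 := mul_pos (hx0 i) (hp _ (hx0 i).le)
    nlinarith [mul_pos h2 (neg_pos.2 h1)]
  · have hp0 : p ≠ 0 := fun h => by simpa [h] using hp 0 le_rfl
    filter_upwards [wronskiOp_sign_eventually c hp0 (rootProd_ne_zero hd x),
      rootProd_sign_eventually hd x, eventually_ge_atTop 0] with t h1 h2 h3
    have h4 := hp t h3
    have h5 : 0 < (rootProd d x).eval t * (wronskiOp c p (rootProd d x)).eval t := by
      rw [mul_assoc] at h1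
      exact (pos_iff_pos_of_mul_pos h1).1 h4
    rcases neg_one_pow_eq_or ℝ n with e | e <;> rw [e] at h2 ⊢
    · rw [one_mul] at *
      exact (pos_iff_pos_of_mul_pos h5).1 h2
    · nlinarith

theorem wronskiOp_exists_roots {n : ℕ} {d : ℝ} (hd : 0 < d) {x : Fin n → ℝ}
    (hx : StrictMono x) (hx0 : ∀ i, 0 < x i) {p : ℝ[X]} (hp : ∀ t, 0 ≤ t → 0 < p.eval t)
    (c : ℝ) :
    ∃ r : Fin n → ℝ, StrictMono r ∧ (∀ i, x i < r i) ∧ (∀ i l, i < l → r i < x l) ∧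
      ∀ i, (wronskiOp c p (rootProd d x)).IsRoot (r i) := by
  obtain ⟨h1, h2⟩ := wronskiOp_rootProd_sign hd hx hx0 hp c
  exact exists_interlacing_roots hx _ h1 h2

/-- At 0 the operator equals -c p(0) q(0) < 0, so 0 serves as an additional node. Negating the
operator restores the sign pattern on the lengthened list of nodes. -/
theorem wronskiOp_exists_roots_succ {n : ℕ} {d : ℝ} (hd : 0 < d) {x : Fin n → ℝ}
    (hx : StrictMono x) (hx0 : ∀ i, 0 < x i) {p : ℝ[X]} (hp : ∀ t, 0 ≤ t → 0 < p.eval t)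
    {c : ℝ} (hc : 0 < c) :
    ∃ r : Fin (n + 1) → ℝ, StrictMono r ∧ (∀ i, 0 < r i) ∧ (∀ i, r 0 < x i) ∧
      ∀ i, (wronskiOp c p (rootProd d x)).IsRoot (r i) := by
  obtain ⟨h1, h2⟩ := wronskiOp_rootProd_sign hd hx hx0 hp c
  have hmono : StrictMono (Fin.cons 0 x : Fin (n + 1) → ℝ) := by
    intro i l hil
    induction l using Fin.cases with
    | zero => exact absurd hil (by simp)
    | succ l =>
      induction i using Fin.cases with
      | zero => simpa using hx0 l
      | succ i => simpa using hx (by simpa using hil)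
  obtain ⟨r, hr, hr1, hr2, hr3⟩ := exists_interlacing_roots hmono
    (-wronskiOp c p (rootProd d x)) (fun i => by
      induction i using Fin.cases with
      | zero =>
        have hq : 0 < (rootProd d x).eval 0 := by
          rw [rootProd_eval]
          exact mul_pos hd (Finset.prod_pos fun j _ => by simpa using hx0 j)
        have := mul_pos (mul_pos hc (hp 0 le_rfl)) hq
        simpa [wronskiOp] using this
      | succ i =>
        have := h1 i
        rw [Fin.cons_succ, eval_neg, Fin.val_succ, pow_succ]
        linarith) (by
      filter_upwards [h2] with t ht
      rw [eval_neg, pow_succ]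
      linarith)
  refine ⟨r, hr, fun i => ?_, fun i => ?_, fun i => ?_⟩
  · exact (hr1 0).trans_le (hr.monotone (Fin.zero_le i))
  · simpa using hr2 0 i.succ (Fin.succ_pos i)
  · simpa using hr3 i

/-! ### Factorization from known roots; the zeros of Laguerre polynomials. -/

theorem eq_rootProd_of_roots {n : ℕ} {f : ℝ[X]} {d : ℝ} {x : Fin n → ℝ} (hf : f.natDegree ≤ n)
    (hc : f.coeff n = (-1) ^ n * d) (hx : Function.Injective x) (hr : ∀ i, f.IsRoot (x i)) :
    f = rootProd d x := by
  have e : rootProd d x = C ((-1) ^ n * d) * ∏ j, (X - C (x j)) := by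
    have : ∏ j, (C (x j) - X) = C ((-1) ^ n) * ∏ j, (X - C (x j)) := by
      rw [Finset.prod_congr rfl fun j _ => (neg_sub X (C (x j))).symm, Finset.prod_neg]
      simp
    rw [rootProd, this, C_mul]
    ring
  have hmon : (∏ j, (X - C (x j))).Monic := monic_prod_of_monic _ _ fun j _ => monic_X_sub_C _
  have hdeg : (∏ j, (X - C (x j))).natDegree = n := by
    rw [natDegree_prod_of_monic _ _ fun j _ => monic_X_sub_C _]
    simp
  refine eq_of_degree_sub_lt_of_eval_index_eq Finset.univ hx.injOn ?_ fun i _ => ?_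
  · rw [Finset.card_univ, Fintype.card_fin, degree_lt_iff_coeff_zero]
    intro k hk
    rw [coeff_sub, e, coeff_C_mul]
    rcases hk.eq_or_lt with h | h
    · subst h
      have := hmon.coeff_natDegree
      rw [hdeg] at this
      rw [this, hc, mul_one, sub_self]
    · rw [coeff_eq_zero_of_natDegree_lt (hf.trans_lt h),
        coeff_eq_zero_of_natDegree_lt (hdeg.trans_lt h), mul_zero, sub_self]
  · rw [rootProd_eval_self, hr i]

theorem exists_eq_of_isRoot {ι : Type*} [Fintype ι] {f : ℝ[X]} (hf : f ≠ 0)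
    (hd : f.natDegree ≤ Fintype.card ι) {g : ι → ℝ} (hg : Function.Injective g)
    (hr : ∀ i, f.IsRoot (g i)) {t : ℝ} (ht : f.IsRoot t) : ∃ i, g i = t := by
  classical
  have hsub : Finset.univ.image g ⊆ f.roots.toFinset := by
    intro y hy
    obtain ⟨i, -, rfl⟩ := Finset.mem_image.1 hy
    simpa [hf] using hr i
  have hcard : f.roots.toFinset.card ≤ (Finset.univ.image g).card := by
    rw [Finset.card_image_of_injective _ hg, Finset.card_univ]
    exact (Multiset.toFinset_card_le _).trans ((card_roots' f).trans hd)
  have := Finset.eq_of_subset_of_card_le hsub hcard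
  have hm : t ∈ f.roots.toFinset := by simpa [hf] using ht
  rw [← this] at hm
  simpa using hm

/-- Induction on the degree, with the parameter raised by one: (n+1) L_{n+1}^a is minus the operator
applied to p = 1, q = L_n^{a+1} with c = a+1 > 0, so the same root count applies. -/
theorem exists_laguerrePoly_eq_rootProd (n : ℕ) (a : ℝ) (ha : -1 < a) :
    ∃ x : Fin n → ℝ, StrictMono x ∧ (∀ i, 0 < x i) ∧
      laguerrePoly n a = rootProd (1 / (n.factorial : ℝ)) x := by
  induction n generalizing a with
  | zero => exact ⟨Fin.elim0, fun i => i.elim0, fun i => i.elim0, by simp [laguerrePoly, rootProd]⟩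
  | succ n ih =>
    obtain ⟨x, hx, hx0, e⟩ := ih (a + 1) (by linarith)
    obtain ⟨r, hr, hr0, -, hr1⟩ := wronskiOp_exists_roots_succ (d := 1 / (n.factorial : ℝ))
      (by positivity) hx hx0 (p := 1) (by simp) (c := a + 1) (by linarith)
    refine ⟨r, hr, hr0, eq_rootProd_of_roots (laguerrePoly_natDegree_le _ _) ?_ hr.injective
      fun i => ?_⟩
    · rw [laguerrePoly_coeff_self]
      ring
    · have h := congrArg (eval (r i)) (laguerrePoly_succ n (a + 1))
      have h2 : (wronskiOp (a + 1) 1 (laguerrePoly n (a + 1))).eval (r i) = 0 := by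
        rw [e]
        exact hr1 i
      rw [add_sub_cancel_right] at h
      simp only [wronskiOp, eval_mul, eval_add, eval_sub, eval_X, eval_C, derivative_one,
        eval_zero, eval_one] at h h2
      have h3 : ((n : ℝ) + 1) * (laguerrePoly (n + 1) a).eval (r i) = 0 := by
        rw [h]
        linear_combination -h2
      exact (mul_eq_zero.1 h3).resolve_left (by positivity)

/-! ### Logarithmic derivative estimates. -/

/-- Division-free form of (e - t) ∑ (x_j - t)⁻² ≤ ∑ (x_j - t)⁻¹, where the sums are (q'² - q q'')/q²
and -q'/q. -/
theorem prod_logDeriv_bounds {ι : Type*} (s : Finset ι) {d e t : ℝ} (hd : 0 < d) (x : ι → ℝ)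
    (hx : ∀ j ∈ s, e ≤ x j) (ht : t < e) (q : ℝ[X]) (hq : q = C d * ∏ j ∈ s, (C (x j) - X)) :
    0 < q.eval t ∧ (derivative q).eval t ≤ 0 ∧
    0 ≤ (derivative q).eval t ^ 2 - q.eval t * (derivative (derivative q)).eval t ∧
    (e - t) * ((derivative q).eval t ^ 2 - q.eval t * (derivative (derivative q)).eval t) ≤
      -(q.eval t * (derivative q).eval t) := by
  classical
  induction s using Finset.induction_on generalizing q with
  | empty =>
    subst hq
    simp [hd]
  | insert i s hi ih =>
    obtain ⟨h1, h2, h3, h4⟩ := ih (fun j hj => hx j (Finset.mem_insert_of_mem hj)) _ rfl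
    rw [Finset.prod_insert hi, mul_left_comm] at hq
    set p : ℝ[X] := C d * ∏ j ∈ s, (C (x j) - X)
    have hxi := hx i (Finset.mem_insert_self i s)
    have d1 : derivative q = -p + (C (x i) - X) * derivative p := by
      rw [hq, derivative_mul]
      simp
    have d2 : derivative (derivative q) =
        -2 * derivative p + (C (x i) - X) * derivative (derivative p) := by
      rw [d1, derivative_add, derivative_mul, derivative_neg]
      simp
      ring
    rw [d2, d1, hq]
    simp only [eval_add, eval_mul, eval_sub, eval_neg, eval_C, eval_X, eval_ofNat]
    set A := p.eval t
    set B := (derivative p).eval t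
    set D := (derivative (derivative p)).eval t
    have hu : 0 < x i - t := by linarith
    have key : (-A + (x i - t) * B) ^ 2 - (x i - t) * A * (-2 * B + (x i - t) * D) =
        A ^ 2 + (x i - t) ^ 2 * (B ^ 2 - A * D) := by ring
    rw [key]
    refine ⟨by positivity, ?_, by positivity, ?_⟩
    · nlinarith [mul_nonneg hu.le (neg_nonneg.2 h2)]
    · have h5 := mul_le_mul_of_nonneg_left h4 (sq_nonneg (x i - t))
      have h6 := mul_le_mul_of_nonneg_right (sub_le_sub_right hxi t) (sq_nonneg A)
      nlinarith

theorem rootProd_eval_pos {n : ℕ} {d : ℝ} (hd : 0 < d) {x : Fin n → ℝ} (hx0 : ∀ i, 0 < x i)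
    {t : ℝ} (ht : t ≤ 0) : 0 < (rootProd d x).eval t := by
  rw [rootProd_eval]
  exact mul_pos hd (Finset.prod_pos fun j _ => by linarith [hx0 j])

/-- The preceding bound at t = 0, e = x_0 gives x_0 ≤ (∑ 1/x_j) / (∑ 1/x_j²). The differential
equation and its derivative at 0 evaluate both sums. -/
theorem laguerrePoly_smallest_root_le {n : ℕ} {a : ℝ} (ha : -1 < a) {d : ℝ} (hd : 0 < d)
    {x : Fin (n + 1) → ℝ} (hx : StrictMono x) (hx0 : ∀ i, 0 < x i)
    (e : laguerrePoly (n + 1) a = rootProd d x) :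
    x 0 ≤ (a + 1) * (a + 2) / (n + a + 2) := by
  obtain ⟨h1, -, -, h4⟩ := prod_logDeriv_bounds Finset.univ hd x
    (fun j _ => hx.monotone (Fin.zero_le j)) (hx0 0) (laguerrePoly (n + 1) a) e
  have o1 := congrArg (eval 0) (laguerrePoly_ode (n + 1) a)
  have o2 := congrArg (fun p => eval 0 (derivative p)) (laguerrePoly_ode (n + 1) a)
  simp only [derivative_add, derivative_mul, derivative_sub, derivative_C, derivative_X, eval_add,
    eval_mul, eval_sub, eval_C, eval_X, eval_zero, eval_one, derivative_zero] at o1 o2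
  set A := (laguerrePoly (n + 1) a).eval 0
  set B := (derivative (laguerrePoly (n + 1) a)).eval 0
  set D := (derivative (derivative (laguerrePoly (n + 1) a))).eval 0
  push_cast at o1 o2
  have ha1 : 0 < a + 1 := by linarith
  have ha2 : 0 < a + 2 := by linarith
  have hB : B = -((n : ℝ) + 1) * A / (a + 1) := by
    field_simp
    linear_combination o1
  have hD : D = -(n : ℝ) * B / (a + 2) := by
    field_simp
    linear_combination o2
  have hn : (0 : ℝ) ≤ n := n.cast_nonneg
  rw [le_div_iff₀ (by linarith)]
  rw [hD, hB] at h4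
  have h5 := mul_le_mul_of_nonneg_left h4 (by positivity : 0 ≤ (a + 1) ^ 2 * (a + 2))
  field_simp at h5
  linarith

/-- Since q q'' ≤ q'², the differential equation at -t yields n ≤ t v² + (a+1+t) v for v = -q'/q ≥
0, so v < K would contradict `hn`. -/
theorem laguerrePoly_derivative_le {n : ℕ} {a : ℝ} (ha : -1 < a) {d : ℝ} (hd : 0 < d)
    {x : Fin n → ℝ} (hx0 : ∀ i, 0 < x i) (e : laguerrePoly n a = rootProd d x)
    {t K : ℝ} (ht : 0 < t) (hn : t * K ^ 2 + (a + 1 + t) * K < n) :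
    K * (laguerrePoly n a).eval (-t) ≤ -(derivative (laguerrePoly n a)).eval (-t) := by
  obtain ⟨h1, h2, h3, -⟩ := prod_logDeriv_bounds (e := 0) (t := -t) Finset.univ hd x
    (fun j _ => (hx0 j).le) (by linarith) (laguerrePoly n a) e
  have o1 := congrArg (eval (-t)) (laguerrePoly_ode n a)
  simp only [eval_add, eval_mul, eval_sub, eval_C, eval_X, eval_zero] at o1
  set A := (laguerrePoly n a).eval (-t)
  set B := (derivative (laguerrePoly n a)).eval (-t)
  set D := (derivative (derivative (laguerrePoly n a))).eval (-t)
  by_contra! hc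
  have k1 : t * (A * D) ≤ t * B ^ 2 := mul_le_mul_of_nonneg_left (by linarith) ht.le
  have k2 : B ^ 2 ≤ (K * A) ^ 2 := by nlinarith
  have k3 : t * B ^ 2 ≤ t * (K * A) ^ 2 := mul_le_mul_of_nonneg_left k2 ht.le
  have k4 : (a + 1 + t) * A * (-B) ≤ (a + 1 + t) * A * (K * A) :=
    mul_le_mul_of_nonneg_left hc.le (mul_nonneg (by linarith) h1.le)
  have k5 := mul_lt_mul_of_pos_right hn (pow_pos h1 2)
  have k6 : t * (A * D) = A * ((a + 1 + t) * B + n * A) := by linear_combination -A * o1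
  nlinarith

/-! ### Exceptional polynomials in terms of the operator; all their roots. -/

theorem laguerrePolyNeg_eval (n : ℕ) (a t : ℝ) :
    (laguerrePolyNeg n a).eval t = (laguerrePoly n a).eval (-t) := by
  simp [laguerrePolyNeg]

theorem laguerrePolyNeg_derivative_eval (n : ℕ) (a t : ℝ) :
    (derivative (laguerrePolyNeg n a)).eval t = -(derivative (laguerrePoly n a)).eval (-t) := by
  simp [laguerrePolyNeg, derivative_comp]

theorem laguerrePolyNeg_natDegree_le (n : ℕ) (a : ℝ) : (laguerrePolyNeg n a).natDegree ≤ n := by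
  rw [laguerrePolyNeg, natDegree_comp, natDegree_neg, natDegree_X, mul_one]
  exact laguerrePoly_natDegree_le n a

theorem laguerrePolyNeg_succ_eval (n : ℕ) (a t : ℝ) :
    ((n : ℝ) + 1) * (laguerrePolyNeg (n + 1) (a - 1)).eval t =
      (a + t) * (laguerrePolyNeg n a).eval t + t * (derivative (laguerrePolyNeg n a)).eval t := by
  have := congrArg (eval (-t)) (laguerrePoly_succ n a)
  simp only [eval_mul, eval_add, eval_sub, eval_C, eval_X] at this
  rw [laguerrePolyNeg_derivative_eval, laguerrePolyNeg_eval, laguerrePolyNeg_eval, this]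
  ring

theorem typeIIILaguerre_eq_wronskiOp (m n : ℕ) (α : ℝ) :
    typeIIILaguerre m (m + (n + 1)) α =
      wronskiOp (α + 1) (laguerrePolyNeg m (-α - 1)) (laguerrePoly n (α + 1)) := by
  rw [typeIIILaguerre, if_neg (by omega), if_pos (by omega), show m + (n + 1) - m - 1 = n by omega,
    typeIIIOperatorA, show -(α + 1) = -α - 1 by ring]
  refine funext fun t => ?_
  have := laguerrePolyNeg_succ_eval m (-α - 1) t
  simp only [wronskiOp, eval_mul, eval_add, eval_sub, eval_neg, eval_C, eval_X]
  linear_combination (laguerrePoly n (α + 1)).eval t * this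

theorem typeIIILaguerre_eval_neg (m n : ℕ) (α t : ℝ) :
    (typeIIILaguerre m (m + (n + 1)) α).eval (-t) =
      -(wronskiOp (-(α + 1)) (laguerrePolyNeg n (α + 1)) (laguerrePoly m (-α - 1))).eval t := by
  rw [typeIIILaguerre_eq_wronskiOp]
  simp only [wronskiOp, eval_mul, eval_add, eval_sub, eval_C, eval_X,
    laguerrePolyNeg_eval, laguerrePolyNeg_derivative_eval, neg_neg]
  ring

theorem wronskiOp_natDegree_le (c : ℝ) {p q : ℝ[X]} {m n : ℕ} (hp : p.natDegree ≤ m)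
    (hq : q.natDegree ≤ n) : (wronskiOp c p q).natDegree ≤ m + n + 1 := by
  have hp' := (natDegree_derivative_le p).trans ((Nat.sub_le _ 1).trans hp)
  have hq' := (natDegree_derivative_le q).trans ((Nat.sub_le _ 1).trans hq)
  have h1 : (X - C c : ℝ[X]).natDegree ≤ 1 := (natDegree_X_sub_C c).le
  have h2 : (X : ℝ[X]).natDegree ≤ 1 := natDegree_X_le
  refine natDegree_add_le_of_degree_le ?_ ?_
  · exact (natDegree_mul_le_of_le (natDegree_mul_le_of_le h1 hp) hq).trans (by omega)
  · refine (natDegree_mul_le_of_le h2 (natDegree_sub_le_of_le (natDegree_mul_le_of_le hp' hq)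
      (natDegree_mul_le_of_le hp hq'))).trans (by simp; omega)

theorem laguerrePoly_eval_pos (n : ℕ) {a t : ℝ} (ha : -1 < a) (ht : t ≤ 0) :
    0 < (laguerrePoly n a).eval t := by
  obtain ⟨x, -, hx0, e⟩ := exists_laguerrePoly_eq_rootProd n a ha
  rw [e]
  exact rootProd_eval_pos (by positivity) hx0 ht

theorem typeIIILaguerre_exists_roots (m n : ℕ) {α : ℝ} (hα₁ : -1 < α) (hα₂ : α < 0) {d : ℝ}
    (hd : 0 < d) {w : Fin m → ℝ} (hw : StrictMono w) (hw0 : ∀ i, 0 < w i)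
    (ew : laguerrePoly m (-α - 1) = rootProd d w) :
    ∃ (r : Fin m → ℝ) (s : Fin (n + 1) → ℝ), StrictMono r ∧ (∀ i, w i < r i) ∧
      (∀ i l, i < l → r i < w l) ∧ StrictMono s ∧ (∀ i, 0 < s i) ∧
      (∀ t, (typeIIILaguerre m (m + (n + 1)) α).IsRoot t ↔ (∃ i, -r i = t) ∨ ∃ i, s i = t) ∧
      (1 ≤ n → s 0 ≤ (α + 2) * (α + 3) / (n + α + 2)) := by
  obtain ⟨x, hx, hx0, ex⟩ := exists_laguerrePoly_eq_rootProd n (α + 1) (by linarith)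
  have hα : -1 < -α - 1 := by linarith
  obtain ⟨r, hr, hr1, hr2, hr3⟩ := wronskiOp_exists_roots hd hw hw0
    (p := laguerrePolyNeg n (α + 1)) (fun t ht => by
      rw [laguerrePolyNeg_eval]
      exact laguerrePoly_eval_pos n (by linarith) (by linarith)) (-(α + 1))
  obtain ⟨s, hs, hs1, hs2, hs3⟩ := wronskiOp_exists_roots_succ (d := 1 / (n.factorial : ℝ))
    (by positivity) hx hx0 (p := laguerrePolyNeg m (-α - 1)) (fun t ht => by
      rw [laguerrePolyNeg_eval]
      exact laguerrePoly_eval_pos m hα (by linarith)) (c := α + 1) (by linarith)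
  rw [← ew] at hr3
  rw [← ex, ← typeIIILaguerre_eq_wronskiOp] at hs3
  have hr4 : ∀ i, (typeIIILaguerre m (m + (n + 1)) α).IsRoot (-r i) := fun i => by
    rw [IsRoot.def, typeIIILaguerre_eval_neg, hr3 i, neg_zero]
  have h0 : typeIIILaguerre m (m + (n + 1)) α ≠ 0 := by
    intro h
    have h1 := congrArg (eval 0) h
    have h2 := laguerrePoly_eval_pos m hα le_rfl
    have h3 := laguerrePoly_eval_pos n (a := α + 1) (by linarith) le_rfl
    rw [typeIIILaguerre_eq_wronskiOp] at h1
    simp [wronskiOp, laguerrePolyNeg_eval, h2.ne', h3.ne'] at h1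
    linarith
  have hdeg : (typeIIILaguerre m (m + (n + 1)) α).natDegree ≤
      Fintype.card (Fin m ⊕ Fin (n + 1)) := by
    rw [typeIIILaguerre_eq_wronskiOp, Fintype.card_sum, Fintype.card_fin, Fintype.card_fin]
    exact wronskiOp_natDegree_le _ (laguerrePolyNeg_natDegree_le _ _)
      (laguerrePoly_natDegree_le _ _)
  have hrpos : ∀ i, 0 < r i := fun i => (hw0 i).trans (hr1 i)
  -- The two families have opposite signs, so together they give m + n + 1 distinct roots and
  -- exhaust the degree.
  have hinj : Function.Injective (Sum.elim (fun i => -r i) s) := by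
    refine Function.Injective.sumElim (neg_injective.comp hr.injective) hs.injective fun i l h => ?_
    linarith [hrpos i, hs1 l]
  refine ⟨r, s, hr, hr1, hr2, hs, hs1, fun t => ⟨fun ht => ?_, ?_⟩, fun hn => ?_⟩
  · obtain ⟨i, hi⟩ := exists_eq_of_isRoot h0 hdeg hinj
      (fun i => by rcases i with i | i <;> simp [-IsRoot.def, hr4, hs3]) ht
    rcases i with i | i
    · exact Or.inl ⟨i, hi⟩
    · exact Or.inr ⟨i, hi⟩
  · rintro (⟨i, rfl⟩ | ⟨i, rfl⟩)
    · exact hr4 i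
    · exact hs3 i
  · obtain ⟨n, rfl⟩ := Nat.exists_eq_add_of_le' hn
    have h := laguerrePoly_smallest_root_le (by linarith) (by positivity) hx hx0 ex
    refine (hs2 0).le.trans (h.trans (le_of_eq ?_))
    push_cast
    ring_nf

/-! ### Limits of the roots. -/

theorem wronskiOp_root_near {m : ℕ} {d : ℝ} (hd : 0 < d) {w : Fin m → ℝ} (hw : StrictMono w)
    (hw0 : ∀ i, 0 < w i) {b : ℝ} (hb : 0 < b) (i : Fin m) {t : ℝ} (hit : w i < t)
    (htl : ∀ l, i < l → t < w l) :
    ∀ᶠ n : ℕ in atTop, ∃ r, w i < r ∧ r < t ∧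
      (wronskiOp (-b) (laguerrePolyNeg n b) (rootProd d w)).IsRoot r := by
  have t0 : 0 < t := (hw0 i).trans hit
  set q := rootProd d w with hq
  have s1 := rootProd_derivative_sign hd hw i
  have s2 := rootProd_sign hd w t (i + 1) (by omega)
    (fun j hj => (hw.monotone (Fin.le_def.2 (by omega))).trans_lt hit)
    (fun j hj => htl j (Fin.lt_def.2 (by omega)))
  rw [← hq] at s1 s2
  have hL : q.eval t ≠ 0 := fun h => by simp [h] at s2
  -- Once the logarithmic derivative of the Laguerre factor is at least this K, the operator at t
  -- has the sign of q(t), which is opposite to its sign at w_i.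
  set K := |(derivative q).eval t / q.eval t| with hK
  filter_upwards [tendsto_natCast_atTop_atTop.eventually_gt_atTop
    (t * K ^ 2 + (b + 1 + t) * K)] with n hn
  refine exists_root_of_mul_neg _ hit ?_
  obtain ⟨x, hx, hx0, ex⟩ := exists_laguerrePoly_eq_rootProd n b (by linarith)
  have hy := laguerrePoly_derivative_le (by linarith) (by positivity) hx0 ex t0 hn
  have hu := laguerrePoly_eval_pos n (a := b) (t := -t) (by linarith) (by linarith)
  have hui := laguerrePoly_eval_pos n (a := b) (t := -w i) (by linarith) (by linarith [hw0 i])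
  rw [hq, wronskiOp_eval_root, ← hq]
  simp only [wronskiOp, eval_mul, eval_add, eval_sub, eval_C, eval_X,
    laguerrePolyNeg_eval, laguerrePolyNeg_derivative_eval]
  set u := (laguerrePoly n b).eval (-t)
  set v := -(derivative (laguerrePoly n b)).eval (-t)
  set L := q.eval t
  set L' := (derivative q).eval t
  have e : (t - -b) * u * L + t * (v * L - u * L') = L * ((t + b) * u + t * (v - L' / L * u)) := by
    field_simp
    ring
  rw [e]
  have h1 : L' / L * u ≤ K * u := mul_le_mul_of_nonneg_right (le_abs_self _) hu.le
  have h2 : 0 < (t + b) * u + t * (v - L' / L * u) :=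
    add_pos_of_pos_of_nonneg (mul_pos (by linarith) hu) (mul_nonneg t0.le (by linarith))
  have h3 : 0 < (derivative q).eval (w i) * L := by
    have h := mul_pos (neg_pos.2 s1) s2
    have e2 : -((-1) ^ (i : ℕ) * (derivative q).eval (w i)) * ((-1) ^ ((i : ℕ) + 1) * L) =
        ((-1) ^ (i : ℕ)) ^ 2 * ((derivative q).eval (w i) * L) := by ring
    rw [e2, ← pow_mul, mul_comm (i : ℕ) 2, pow_mul] at h
    simpa using h
  have h4 := mul_pos (mul_pos (mul_pos (hw0 i) hui) h2) h3
  nlinarith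

theorem mainTheorem5 (m : ℕ) (hm : 1 ≤ m) (α : ℝ) (hα₁ : -1 < α) (hα₂ : α < 0) :
    -- the `m` negative roots `ζ k i` converge, in order, to the `m` roots `z i`
    (∃ (z : Fin m → ℝ) (ζ : ℕ → Fin m → ℝ),
      (StrictMono z ∧ Set.range z = {x : ℝ | (laguerrePolyNeg m (-α - 1)).IsRoot x}) ∧
      (∀ k : ℕ, 1 ≤ k → StrictMono (ζ k) ∧
        Set.range (ζ k) = {x : ℝ | x < 0 ∧ (typeIIILaguerre m (m + k) α).IsRoot x}) ∧
      ∀ i : Fin m, Tendsto (fun k : ℕ => ζ k i) atTop (𝓝 (z i))) ∧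
    -- the smallest positive root tends to zero
    (∃ ξ : ℕ → ℝ,
      (∀ k : ℕ, 1 ≤ k →
        IsLeast {x : ℝ | 0 < x ∧ (typeIIILaguerre m (m + k) α).IsRoot x} (ξ k)) ∧
      Tendsto ξ atTop (𝓝 0)) := by
  obtain ⟨w, hw, hw0, ew⟩ := exists_laguerrePoly_eq_rootProd m (-α - 1) (by linarith)
  have hd : 0 < 1 / (m.factorial : ℝ) := by positivity
  choose r s hr hr1 hr2 hs hs0 hroot hs1 using
    fun n => typeIIILaguerre_exists_roots m n hα₁ hα₂ hd hw hw0 ew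
  have hr0 : ∀ n i, 0 < r n i := fun n i => (hw0 i).trans (hr1 n i)
  -- Negation reverses order, hence `i.rev`; the Laguerre factor for k has degree k - 1, and the
  -- truncated value at k = 0 is irrelevant.
  refine ⟨⟨fun i => -w i.rev, fun k i => -r (k - 1) i.rev, ⟨?_, ?_⟩, ?_, ?_⟩,
    fun k => s (k - 1) 0, ?_, ?_⟩
  · exact fun i l h => neg_lt_neg (hw (Fin.rev_lt_rev.2 h))
  · ext t
    simp only [Set.mem_range, Set.mem_ofPred_eq, IsRoot.def, laguerrePolyNeg_eval, ew,
      rootProd_eval, mul_eq_zero, hd.ne', false_or, Finset.prod_eq_zero_iff, Finset.mem_univ,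
      true_and]
    constructor
    · rintro ⟨i, rfl⟩
      exact ⟨i.rev, by ring⟩
    · rintro ⟨i, hi⟩
      exact ⟨i.rev, by rw [Fin.rev_rev]; linarith⟩
  · intro k hk
    obtain ⟨n, rfl⟩ := Nat.exists_eq_add_of_le' hk
    refine ⟨fun i l h => neg_lt_neg (hr _ (Fin.rev_lt_rev.2 h)), ?_⟩
    ext t
    simp only [Set.mem_range, Set.mem_ofPred_eq, hroot, Nat.add_sub_cancel]
    constructor
    · rintro ⟨i, rfl⟩
      exact ⟨neg_lt_zero.2 (hr0 n _), Or.inl ⟨_, rfl⟩⟩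
    · rintro ⟨ht, ⟨i, rfl⟩ | ⟨i, rfl⟩⟩
      · exact ⟨i.rev, by rw [Fin.rev_rev]⟩
      · exact absurd ht (hs0 n i).not_gt
  · intro i
    have key : ∀ i, Tendsto (fun n => r n i) atTop (𝓝 (w i)) := by
      intro i
      refine tendsto_order.2 ⟨fun c hc => Eventually.of_forall fun n => hc.trans (hr1 n i),
        fun c hc => ?_⟩
      have h1 : ∀ᶠ t in 𝓝[>] (w i), ∀ l, i < l → t < w l :=
        eventually_all.2 fun l => by
          by_cases hl : i < l
          · filter_upwards [Ioo_mem_nhdsGT (hw hl)] with t ht _ using ht.2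
          · exact Eventually.of_forall fun t h => absurd h hl
      obtain ⟨t, ht1, ht2⟩ := (h1.and (Ioo_mem_nhdsGT hc)).exists
      filter_upwards [wronskiOp_root_near hd hw hw0 (b := α + 1) (by linarith) i ht2.1 ht1]
        with n hn
      obtain ⟨ρ, hρ1, hρ2, hρ3⟩ := hn
      have hρ : (typeIIILaguerre m (m + (n + 1)) α).IsRoot (-ρ) := by
        rw [IsRoot.def, typeIIILaguerre_eval_neg, ew, hρ3, neg_zero]
      -- Interlacing leaves `r n i` as the only reflected root between w_i and t, so `ρ` must be it.
      rcases (hroot n _).1 hρ with ⟨l, hl⟩ | ⟨l, hl⟩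
      · have hl' : r n l = ρ := neg_injective hl
        rcases lt_trichotomy l i with h | h | h
        · linarith [hr2 n l i h]
        · subst h
          linarith [ht2.2]
        · linarith [hr1 n l, ht1 l h]
      · linarith [hs0 n l, hw0 i]
    exact ((key i.rev).comp (tendsto_sub_atTop_nat 1)).neg
  · intro k hk
    obtain ⟨n, rfl⟩ := Nat.exists_eq_add_of_le' hk
    refine ⟨⟨hs0 _ _, (hroot n _).2 (Or.inr ⟨_, rfl⟩)⟩, fun t ht => ?_⟩
    rcases (hroot n t).1 ht.2 with ⟨i, rfl⟩ | ⟨i, rfl⟩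
    · linarith [hr0 n i, ht.1]
    · exact (hs n).monotone (Fin.zero_le i)
  · have key : Tendsto (fun n => s n 0) atTop (𝓝 0) := by
      have hlim : Tendsto (fun n : ℕ => (α + 2) * (α + 3) / ((n : ℝ) + α + 2)) atTop (𝓝 0) :=
        tendsto_const_nhds.div_atTop (tendsto_atTop_add_const_right _ _
          (tendsto_atTop_add_const_right _ _ tendsto_natCast_atTop_atTop))
      refine tendsto_of_tendsto_of_tendsto_of_le_of_le' tendsto_const_nhds hlim
        (Eventually.of_forall fun n => (hs0 n 0).le) ?_
      filter_upwards [eventually_ge_atTop 1] with n hn using hs1 n hn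
    exact key.comp (tendsto_sub_atTop_nat 1)
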